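/- Let $1\le p<\infty$ and let $(r_k)_{k\ge 1}$, $r_k(t)=\operatorname{sign}\sin(2^k\pi t)$, be the Rademacher sequence in the real Banach lattice $L_p[0,1]$ (Lebesgue measure). Then $(r_k)$ is bibasic, it is permutable, and it is not absolute. Here a sequence $(x_k)_{k\ge1}$ in a real Banach lattice $X$ is called - *bibasic* if it is a Schauder basis of its closed linear span and, whenever a series $\sum_{k=1}^\infty\alpha_kx_k$ with real coefficients converges in norm to some $x\in X$, it also converges uniformly to $x$, i.e. there is $e\in X_+$ such that for every $\varepsilon>0$ there is $n_0$ with $\bigl|\sum_{k=1}^n\alpha_kx_k-x\bigr|\le\varepsilon e$ for all $n\ge n_0$; - *permutable* if $(x_{\sigma(k)})$ is bibasic for every permutation $\sigma$ of $\mathbb N$; - *absolute* if there is a constant $A\ge1$ such that $\bigl\|\sum_{k=1}^m|\alpha_kx_k|\bigr\|\le A\bigl\|\sum_{k=1}^m\alpha_kx_k\bigr\|$ for all $m\in\mathbb N$ and all real $\alpha_1,\dots,\alpha_m$. -/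

import Mathlib

open MeasureTheory Filter Topology
open scoped ENNReal

/-! ### Sequences in Banach lattices

A (real) Banach lattice is a complete normed space with a lattice order and a solid norm
(`HasSolidNorm`). The definitions below mention only the part of that structure which they use.
Sequences are indexed by `ℕ = {0, 1, 2, …}` instead of `{1, 2, …}`. -/

/-- The closed linear span `[x_k]` of a sequence in a normed space. -/
abbrev closedSpan {X : Type*} [NormedAddCommGroup X] [NormedSpace ℝ X] (x : ℕ → X) :
    Submodule ℝ X :=
  (Submodule.span ℝ (Set.range x)).topologicalClosure

/-- `x` is a Schauder basic sequence: it is a Schauder basis (in the classical sense, with norm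
convergence of the partial sums) of its closed linear span. -/
def IsBasicSequence {X : Type*} [NormedAddCommGroup X] [NormedSpace ℝ X] (x : ℕ → X) : Prop :=
  ∃ b : SchauderBasis ℝ (closedSpan x), ∀ k, ((b k : closedSpan x) : X) = x k

/-- Uniform convergence (also called relatively uniform convergence) of a sequence in a vector
lattice: for some `e ≥ 0` and every `ε > 0`, eventually `|y_n - z| ≤ ε e`. -/
def UniformlyConvergesTo {X : Type*} [Lattice X] [AddCommGroup X] [Module ℝ X]
    (y : ℕ → X) (z : X) : Prop :=
  ∃ e : X, 0 ≤ e ∧ ∀ ε : ℝ, 0 < ε → ∃ N : ℕ, ∀ n, N ≤ n → |y n - z| ≤ ε • e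

/-- `x` is a bibasic sequence: it is a Schauder basic sequence and each series `∑ α_k x_k` which
converges in norm to some `z` also converges uniformly to `z`. -/
def IsBibasic {X : Type*} [NormedAddCommGroup X] [Lattice X] [NormedSpace ℝ X]
    (x : ℕ → X) : Prop :=
  IsBasicSequence x ∧
    ∀ (α : ℕ → ℝ) (z : X),
      Tendsto (fun n : ℕ => ∑ k ∈ Finset.range n, α k • x k) atTop (𝓝 z) →
        UniformlyConvergesTo (fun n : ℕ => ∑ k ∈ Finset.range n, α k • x k) z

/-- `x` is permutable: every permutation of `x` is bibasic. -/
def IsPermutable {X : Type*} [NormedAddCommGroup X] [Lattice X] [NormedSpace ℝ X]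
    (x : ℕ → X) : Prop :=
  ∀ σ : Equiv.Perm ℕ, IsBibasic (fun k => x (σ k))

/-- `x` is absolute: there is `A ≥ 1` such that `‖∑_{k<m} |α_k x_k|‖ ≤ A ‖∑_{k<m} α_k x_k‖` for all
`m` and all scalars `α_k`. -/
def IsAbsolute {X : Type*} [NormedAddCommGroup X] [Lattice X] [NormedSpace ℝ X]
    (x : ℕ → X) : Prop :=
  ∃ A : ℝ, 1 ≤ A ∧ ∀ (m : ℕ) (α : ℕ → ℝ),
    ‖∑ k ∈ Finset.range m, |α k • x k|‖ ≤ A * ‖∑ k ∈ Finset.range m, α k • x k‖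

/-! ### The Rademacher sequence -/

/-- Lebesgue measure on `[0,1]`. -/
noncomputable abbrev unitIntervalMeasure : Measure ℝ := volume.restrict (Set.Icc (0 : ℝ) 1)

/-- The Rademacher functions `r_{k+1}(t) = sign (sin (2^{k+1} π t))`, `k = 0, 1, 2, …`. -/
noncomputable def rademacherFun (k : ℕ) (t : ℝ) : ℝ :=
  Real.sign (Real.sin (2 ^ (k + 1) * Real.pi * t))

theorem measurable_rademacherFun (k : ℕ) : Measurable (rademacherFun k) := by
  have h : Measurable fun t : ℝ => Real.sin (2 ^ (k + 1) * Real.pi * t) := by fun_prop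
  unfold rademacherFun Real.sign
  exact Measurable.ite (measurableSet_lt h measurable_const) measurable_const
    (Measurable.ite (measurableSet_lt measurable_const h) measurable_const measurable_const)

theorem memLp_rademacherFun (p : ℝ≥0∞) (k : ℕ) :
    MemLp (rademacherFun k) p unitIntervalMeasure := by
  refine MemLp.of_bound (measurable_rademacherFun k).aestronglyMeasurable 1 (ae_of_all _ fun t => ?_)
  rcases Real.sign_apply_eq (Real.sin (2 ^ (k + 1) * Real.pi * t)) with h | h | h <;>
    simp [rademacherFun, h]

/-- The Rademacher sequence as a sequence of elements of `L_p[0,1]`. -/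
noncomputable def rademacher (p : ℝ≥0∞) (k : ℕ) : Lp ℝ p unitIntervalMeasure :=
  (memLp_rademacherFun p k).toLp (rademacherFun k)

/-! Both positive claims rest on one maximal estimate: the pointwise maximum of `|S_m|`, `m ≤ n`,
over the partial sums has norm at most `2‖S_n‖`. It bounds the partial sum projections, so
Grunblum's criterion gives a basic sequence; applied to fast converging blocks, it also turns norm
convergence into uniform convergence (`isBibasic_of_maximal`). For the Rademacher functions the
estimate is Lévy's maximal inequality, integrated over levels. It only needs the joint distribution
to be invariant under sign changes, which follows from self-similarity under halving of the
interval. Sign symmetry survives every permutation, so permutability comes from the same argument,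
and bibasicity is its identity case. Absoluteness fails because `∑ |r_k|` over `m` terms is the
constant `m`, whereas `∑ r_k` has norm `o(m)`, as orthogonality and the bound `|∑ r_k| ≤ m` show. -/

section Basic
-- Grunblum's criterion for basic sequences.
variable {X : Type*} [NormedAddCommGroup X] [NormedSpace ℝ X]

theorem Finsupp.linearCombination_eq_sum_range (x : ℕ → X) (l : ℕ →₀ ℝ) {n : ℕ}
    (hn : ∀ i ∈ l.support, i < n) :
    Finsupp.linearCombination ℝ x l = ∑ k ∈ Finset.range n, l k • x k := by
  rw [Finsupp.linearCombination_apply, Finsupp.sum]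
  refine Finset.sum_subset (fun _ hk => Finset.mem_range.2 (hn _ hk)) fun _ _ hk => ?_
  simp [Finsupp.notMem_support_iff.1 hk]

theorem Finsupp.exists_support_lt (l : ℕ →₀ ℝ) : ∃ n, ∀ k ∈ l.support, k < n :=
  ⟨l.support.sup id + 1, fun _ hk => Nat.lt_succ_of_le (Finset.le_sup (f := id) hk)⟩

/-- A single term is the difference of two consecutive partial sums, whence the factor 2. This makes
the coordinate functionals bounded on the span. -/
theorem norm_coeff_smul_le {x : ℕ → X} {C : ℝ}
    (h : ∀ (α : ℕ → ℝ) (m n : ℕ), m ≤ n →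
      ‖∑ k ∈ Finset.range m, α k • x k‖ ≤ C * ‖∑ k ∈ Finset.range n, α k • x k‖)
    (l : ℕ →₀ ℝ) (k : ℕ) :
    ‖l k • x k‖ ≤ 2 * C * ‖Finsupp.linearCombination ℝ x l‖ := by
  obtain ⟨n, hn⟩ := l.exists_support_lt
  have hn' : ∀ i ∈ l.support, i < max n (k + 1) := fun i hi => lt_max_of_lt_left (hn i hi)
  rw [Finsupp.linearCombination_eq_sum_range x l hn']
  have h1 := h l k (max n (k + 1)) (by omega)
  have h2 := h l (k + 1) (max n (k + 1)) (by omega)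
  have h3 : l k • x k =
      ∑ i ∈ Finset.range (k + 1), l i • x i - ∑ i ∈ Finset.range k, l i • x i := by
    rw [Finset.sum_range_succ]; abel
  rw [h3]
  refine (norm_sub_le _ _).trans ?_
  linarith

/-- Biorthogonal functionals of a sequence satisfying Grunblum's condition. -/
theorem exists_biorthogonal {x : ℕ → X} (hx : ∀ k, x k ≠ 0) {C : ℝ}
    (h : ∀ (α : ℕ → ℝ) (m n : ℕ), m ≤ n →
      ‖∑ k ∈ Finset.range m, α k • x k‖ ≤ C * ‖∑ k ∈ Finset.range n, α k • x k‖) :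
    ∃ φ : ℕ → StrongDual ℝ X, ∀ i j, φ i (x j) = if i = j then 1 else 0 := by
  have hli : LinearIndependent ℝ x := by
    refine linearIndependent_iff.2 fun l hl => ?_
    ext k
    have := norm_coeff_smul_le h l k
    rw [hl, norm_zero, mul_zero] at this
    simpa [hx k] using this
  have key : ∀ i, ∃ f : StrongDual ℝ X, ∀ j, f (x j) = if i = j then 1 else 0 := by
    intro i
    -- The coordinate functional is bounded on the span, so Hahn–Banach extends it to `X`.
    let g : Submodule.span ℝ (Set.range x) →ₗ[ℝ] ℝ := (Finsupp.lapply i).comp hli.repr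
    have hg : ∀ y, ‖g y‖ ≤ (2 * C / ‖x i‖) * ‖y‖ := by
      intro y
      have h1 := norm_coeff_smul_le h (hli.repr y) i
      rw [hli.linearCombination_repr, norm_smul] at h1
      rw [div_mul_eq_mul_div, le_div_iff₀ (norm_pos_iff.2 (hx i))]
      exact h1
    obtain ⟨f, hf, -⟩ := exists_extension_norm_eq _ (g.mkContinuous _ hg)
    refine ⟨f, fun j => ?_⟩
    have h2 := hf ⟨x j, Submodule.subset_span ⟨j, rfl⟩⟩
    rw [h2]
    change hli.repr ⟨x j, _⟩ i = _
    rw [hli.repr_eq_single j _ rfl, Finsupp.single_apply]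
    simp [eq_comm]
  choose φ hφ using key
  exact ⟨φ, hφ⟩

/-- **Grunblum's criterion**. -/
theorem isBasicSequence_of_norm_sum_le {x : ℕ → X} (hx : ∀ k, x k ≠ 0) {C : ℝ}
    (h : ∀ (α : ℕ → ℝ) (m n : ℕ), m ≤ n →
      ‖∑ k ∈ Finset.range m, α k • x k‖ ≤ C * ‖∑ k ∈ Finset.range n, α k • x k‖) :
    IsBasicSequence x := by
  obtain ⟨φ, hφ⟩ := exists_biorthogonal hx h
  have hC : 0 ≤ C := by
    have h1 := h (fun _ => 1) 1 1 le_rfl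
    have h2 : 0 < ‖∑ k ∈ Finset.range 1, (fun _ : ℕ => (1 : ℝ)) k • x k‖ := by simpa using hx 0
    nlinarith
  let P : ℕ → X →L[ℝ] X := fun n => ∑ k ∈ Finset.range n, (φ k).smulRight (x k)
  have hP : ∀ n y, P n y = ∑ k ∈ Finset.range n, φ k y • x k := by
    intro n y; simp [P]
  have hφl : ∀ (l : ℕ →₀ ℝ) k, φ k (Finsupp.linearCombination ℝ x l) = l k := by
    intro l k
    rw [Finsupp.linearCombination_apply, Finsupp.sum, map_sum]
    simp [hφ, eq_comm]
  have hbound_span : ∀ n, ∀ y ∈ Submodule.span ℝ (Set.range x), ‖P n y‖ ≤ C * ‖y‖ := by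
    intro n y hy
    obtain ⟨l, rfl⟩ := (Finsupp.mem_span_range_iff_exists_finsupp).1 hy
    obtain ⟨N, hN⟩ := l.exists_support_lt
    rw [← Finsupp.linearCombination_apply, hP]
    simp only [hφl]
    rw [Finsupp.linearCombination_eq_sum_range x l (n := max n N)
      fun k hk => lt_max_of_lt_right (hN k hk)]
    exact h l n _ (le_max_left _ _)
  have hbound : ∀ n, ∀ y ∈ closedSpan x, ‖P n y‖ ≤ C * ‖y‖ := by
    intro n y hy
    have hcl : IsClosed {y : X | ‖P n y‖ ≤ C * ‖y‖} :=
      isClosed_le (by fun_prop) (by fun_prop)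
    exact closure_minimal (hbound_span n) hcl hy
  have hconv : ∀ y ∈ closedSpan x, Tendsto (fun n => P n y) atTop (𝓝 y) := by
    intro y hy
    rw [Metric.tendsto_atTop]
    intro ε hε
    -- For large `n`, `P n` fixes `w`, so `P n y - y = (P n - 1) (y - w)`, which costs the factor `C
    -- + 1`.
    obtain ⟨w, hw, hwy⟩ := Metric.mem_closure_iff.1 hy (ε / (C + 1)) (by positivity)
    obtain ⟨l, rfl⟩ := (Finsupp.mem_span_range_iff_exists_finsupp).1 hw
    rw [← Finsupp.linearCombination_apply] at *
    set w := Finsupp.linearCombination ℝ x l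
    obtain ⟨N, hN⟩ := l.exists_support_lt
    refine ⟨N, fun n hn => ?_⟩
    have hPw : P n w = w := by
      rw [hP]
      simp only [w, hφl]
      exact (Finsupp.linearCombination_eq_sum_range x l fun k hk => (hN k hk).trans_le hn).symm
    have h1 : ‖P n (y - w)‖ ≤ C * ‖y - w‖ :=
      hbound n _ (Submodule.sub_mem _ hy (subset_closure hw))
    rw [dist_eq_norm] at hwy ⊢
    have h2 : P n y - y = P n (y - w) - (y - w) := by rw [map_sub, hPw]; abel
    rw [h2]
    calc ‖P n (y - w) - (y - w)‖ ≤ (C + 1) * ‖y - w‖ := (norm_sub_le _ _).trans (by linarith)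
      _ < (C + 1) * (ε / (C + 1)) := by gcongr
      _ = ε := by field_simp
  refine ⟨{ basis := fun k => ⟨x k, subset_closure (Submodule.subset_span ⟨k, rfl⟩)⟩
            coord := fun k => (φ k).comp (closedSpan x).subtypeL
            ortho := fun i j => ?_
            expansion := fun y => ?_ }, fun k => rfl⟩
  · simp [hφ, Pi.single_apply]
  · rw [HasSum, SummationFilter.conditional_filter_eq_map_range, tendsto_map'_iff,
      tendsto_subtype_rng]
    refine (hconv y y.2).congr fun n => ?_
    simp [hP]

end Basic

/-! ### From a maximal inequality to uniform convergence in Banach lattices. -/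

section Lattice
variable {X : Type*} [NormedAddCommGroup X] [Lattice X] [HasSolidNorm X] [IsOrderedAddMonoid X]
  [NormedSpace ℝ X] [PosSMulMono ℝ X] [CompleteSpace X]

/-- A convergent sequence whose increments over suitable blocks satisfy a maximal inequality
converges uniformly. -/
theorem uniformlyConvergesTo_of_maximal {y : ℕ → X} {z : X} {C : ℝ}
    (h : ∀ m n, m ≤ n → ∃ B : X, (∀ k, m ≤ k → k ≤ n → |y k - y m| ≤ B) ∧ ‖B‖ ≤ C * ‖y n - y m‖)
    (hy : Tendsto y atTop (𝓝 z)) : UniformlyConvergesTo y z := by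
  have hcauchy := Metric.cauchySeq_iff.1 hy.cauchySeq
  -- Increments of size `4⁻ʲ` leave room for the weights `2ʲ` in the regulator `e = ∑ 2ʲ B j`: the
  -- series still converges, and the tail of `∑ B j` from `j` on is at most `2⁻ʲ e`.
  choose M hM using fun j : ℕ => hcauchy ((1 / 4 : ℝ) ^ j) (by positivity)
  let N : ℕ → ℕ := fun j => Nat.rec (M 0) (fun j r => max (r + 1) (M (j + 1))) j
  have hNs : ∀ j, N (j + 1) = max (N j + 1) (M (j + 1)) := fun j => rfl
  have hMN : ∀ j, M j ≤ N j := by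
    intro j; cases j with
    | zero => exact le_rfl
    | succ j => rw [hNs]; exact le_max_right _ _
  have hNmono : StrictMono N := strictMono_nat_of_lt_succ fun j => by rw [hNs]; omega
  choose B hB hBn using fun j => h (N j) (N (j + 1)) (hNmono (Nat.lt_succ_self j)).le
  have hBnn : ∀ j, 0 ≤ B j := fun j => by
    simpa using hB j (N j) le_rfl (hNmono (Nat.lt_succ_self j)).le
  have hincr : ∀ j, ‖y (N (j + 1)) - y (N j)‖ ≤ (1 / 4 : ℝ) ^ j := by
    intro j
    have := hM j (N (j + 1)) ((hMN j).trans (hNmono (Nat.lt_succ_self j)).le) (N j) (hMN j)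
    rw [dist_eq_norm] at this
    exact this.le
  have hBn' : ∀ j, ‖B j‖ ≤ |C| * (1 / 4 : ℝ) ^ j := fun j =>
    (hBn j).trans (by
      refine mul_le_mul (le_abs_self C) (hincr j) (norm_nonneg _) (abs_nonneg C))
  have hsum : Summable fun j => (2 : ℝ) ^ j • B j := by
    refine Summable.of_norm_bounded (g := fun j => |C| * (1 / 2 : ℝ) ^ j)
      (summable_geometric_two.mul_left _) fun j => ?_
    rw [norm_smul, norm_pow, Real.norm_ofNat]
    calc (2 : ℝ) ^ j * ‖B j‖ ≤ 2 ^ j * (|C| * (1 / 4 : ℝ) ^ j) := by gcongr; exact hBn' j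
      _ = |C| * (1 / 2 : ℝ) ^ j := by
        rw [mul_left_comm, ← mul_pow]; norm_num
  set e : X := ∑' j, (2 : ℝ) ^ j • B j
  have hterm : ∀ j, 0 ≤ (2 : ℝ) ^ j • B j := fun j => smul_nonneg (by positivity) (hBnn j)
  have he : 0 ≤ e := tsum_nonneg hterm
  have hpart : ∀ j i, (2 : ℝ) ^ j • ∑ l ∈ Finset.range i, B (j + l) ≤ e := by
    intro j i
    calc (2 : ℝ) ^ j • ∑ l ∈ Finset.range i, B (j + l)
        = ∑ l ∈ Finset.range i, (2 : ℝ) ^ j • B (j + l) := Finset.smul_sum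
      _ ≤ ∑ l ∈ Finset.range i, (2 : ℝ) ^ (j + l) • B (j + l) := by
        refine Finset.sum_le_sum fun l _ => ?_
        have hd : (0 : ℝ) ≤ 2 ^ (j + l) - 2 ^ j :=
          sub_nonneg.2 (pow_le_pow_right₀ (by norm_num) (by omega))
        have := smul_nonneg hd (hBnn (j + l))
        rw [sub_smul] at this
        exact sub_nonneg.1 this
      _ = ∑ l ∈ (Finset.range i).map (addLeftEmbedding j), (2 : ℝ) ^ l • B l := by
        simp
      _ ≤ e := hsum.sum_le_tsum _ fun l _ => hterm l
  have hpart' : ∀ j i, ∑ l ∈ Finset.range i, B (j + l) ≤ (1 / 2 : ℝ) ^ j • e := by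
    intro j i
    have h1 := smul_le_smul_of_nonneg_left (hpart j i) (show (0 : ℝ) ≤ (1 / 2) ^ j by positivity)
    rwa [smul_smul, ← mul_pow, one_div_mul_cancel (two_ne_zero), one_pow, one_smul] at h1
  have htail : ∀ j i, |y (N (j + i)) - y (N j)| ≤ ∑ l ∈ Finset.range i, B (j + l) := by
    intro j i
    induction i with
    | zero => simp
    | succ i ih =>
      rw [Finset.sum_range_succ]
      have h1 : y (N (j + (i + 1))) - y (N j) =
        (y (N (j + i)) - y (N j)) + (y (N (j + i + 1)) - y (N (j + i))) := by
        rw [← add_assoc]; abel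
      rw [h1]
      exact (abs_add_le _ _).trans (add_le_add ih
        (hB (j + i) _ (hNmono (Nat.lt_succ_self _)).le le_rfl))
  have hlim : ∀ j, |z - y (N j)| ≤ (1 / 2 : ℝ) ^ j • e := by
    intro j
    have h1 : Tendsto (fun i => |y (N (j + i)) - y (N j)|) atTop (𝓝 |z - y (N j)|) := by
      have h2 : Tendsto (fun i => y (N (j + i))) atTop (𝓝 z) :=
        hy.comp (hNmono.tendsto_atTop.comp (tendsto_add_atTop_nat j |>.congr fun i => add_comm _ _))
      have h3 := h2.sub_const (y (N j))
      have h4 : Continuous fun a : X => |a| := continuous_id.sup continuous_neg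
      exact (h4.tendsto _).comp h3
    exact le_of_tendsto' h1 fun i => (htail j i).trans (hpart' j i)
  refine ⟨(2 : ℝ) • e, smul_nonneg zero_le_two he, fun ε hε => ?_⟩
  obtain ⟨J, hJ⟩ := exists_pow_lt_of_lt_one hε (show (1 / 2 : ℝ) < 1 by norm_num)
  refine ⟨N J, fun n hn => ?_⟩
  -- `j` is the block containing `n`; searching up to `n` suffices because `j ≤ N j`.
  obtain ⟨j, hj1, hj2, hj3⟩ : ∃ j, N j ≤ n ∧ n < N (j + 1) ∧ J ≤ j := by
    have hJn : J ≤ n := (hNmono.le_apply).trans hn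
    refine ⟨Nat.findGreatest (fun j => N j ≤ n) n,
      Nat.findGreatest_spec (P := fun j => N j ≤ n) hJn hn, ?_, Nat.le_findGreatest hJn hn⟩
    by_contra! hcon
    have := Nat.le_findGreatest (P := fun j => N j ≤ n)
      (m := Nat.findGreatest (fun j => N j ≤ n) n + 1) (hNmono.le_apply.trans hcon) hcon
    omega
  have h1 : |y n - y (N j)| ≤ (1 / 2 : ℝ) ^ j • e :=
    (hB j n hj1 hj2.le).trans (by simpa using hpart' j 1)
  have h2 : |y n - z| ≤ (2 * (1 / 2 : ℝ) ^ j) • e := by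
    calc |y n - z| = |(y n - y (N j)) - (z - y (N j))| := by congr 1; abel
      _ ≤ |y n - y (N j)| + |z - y (N j)| := by
        rw [sub_eq_add_neg]
        exact (abs_add_le _ _).trans_eq (by rw [abs_neg])
      _ ≤ (1 / 2 : ℝ) ^ j • e + (1 / 2 : ℝ) ^ j • e := add_le_add h1 (hlim j)
      _ = (2 * (1 / 2 : ℝ) ^ j) • e := by rw [two_mul, add_smul]
  refine h2.trans ?_
  rw [smul_smul]
  have hd : 0 ≤ ε * 2 - 2 * (1 / 2 : ℝ) ^ j := by
    have : (1 / 2 : ℝ) ^ j ≤ (1 / 2 : ℝ) ^ J :=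
      pow_le_pow_of_le_one (by norm_num) (by norm_num) hj3
    linarith
  have := smul_nonneg hd he
  rw [sub_smul] at this
  exact sub_nonneg.1 this

/-- A sequence of nonzero vectors satisfying the bibasis inequality is bibasic. -/
theorem isBibasic_of_maximal {x : ℕ → X} (hx : ∀ k, x k ≠ 0) {C : ℝ}
    (h : ∀ (α : ℕ → ℝ) (n : ℕ), ∃ B : X,
      (∀ m ≤ n, |∑ k ∈ Finset.range m, α k • x k| ≤ B) ∧
        ‖B‖ ≤ C * ‖∑ k ∈ Finset.range n, α k • x k‖) : IsBibasic x := by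
  refine ⟨isBasicSequence_of_norm_sum_le hx (C := C) fun α m n hmn => ?_, fun α z hz => ?_⟩
  · obtain ⟨B, hB, hBn⟩ := h α n
    exact (HasSolidNorm.solid ((hB m hmn).trans (le_abs_self B))).trans hBn
  · refine uniformlyConvergesTo_of_maximal (C := C) (fun m n hmn => ?_) hz
    -- Deleting the first `m` coefficients turns increments from `m` on into partial sums.
    let β : ℕ → ℝ := fun k => if k < m then 0 else α k
    have hβ : ∀ k, m ≤ k → ∑ i ∈ Finset.range k, β i • x i =
        ∑ i ∈ Finset.range k, α i • x i - ∑ i ∈ Finset.range m, α i • x i := by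
      intro k hk
      rw [← Finset.sum_Ico_eq_sub _ hk, Finset.range_eq_Ico,
        ← Finset.sum_Ico_consecutive _ (Nat.zero_le m) hk,
        Finset.sum_eq_zero (s := Finset.Ico 0 m), zero_add]
      · refine Finset.sum_congr rfl fun i hi => ?_
        simp [β, (Finset.mem_Ico.1 hi).1]
      · intro i hi
        simp [β, (Finset.mem_Ico.1 hi).2]
    obtain ⟨B, hB, hBn⟩ := h β n
    refine ⟨B, fun k hmk hkn => ?_, ?_⟩
    · rw [← hβ k hmk]; exact hB k hkn
    · rw [← hβ n hmn]; exact hBn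

end Lattice

/-! ### Sign-symmetric sequences and Lévy's inequality. -/

/-- The sequence obtained from `x` by changing the signs of the terms with index in `A`. -/
def flipSigns (A : Finset ℕ) (x : ℕ → ℝ) : ℕ → ℝ := fun k => if k ∈ A then -x k else x k

theorem measurable_flipSigns (A : Finset ℕ) : Measurable (flipSigns A) := by
  refine measurable_pi_lambda _ fun k => ?_
  unfold flipSigns
  split_ifs <;> fun_prop

/-- A sequence of random variables is sign-symmetric if its joint distribution does not change when
the signs of finitely many of its terms are changed. -/
def IsSignSymmetric {Ω : Type*} [MeasurableSpace Ω] (μ : Measure Ω) (X : ℕ → Ω → ℝ) : Prop :=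
  ∀ A : Finset ℕ, ProbabilityTheory.IdentDistrib (fun ω => flipSigns A fun k => X k ω)
    (fun ω k => X k ω) μ μ

section
variable {Ω : Type*} [MeasurableSpace Ω] {μ : Measure Ω} {X : ℕ → Ω → ℝ}

theorem IsSignSymmetric.comp_perm (hX : IsSignSymmetric μ X) (σ : Equiv.Perm ℕ) :
    IsSignSymmetric μ fun k => X (σ k) := by
  intro A
  have hm : Measurable fun (x : ℕ → ℝ) k => x (σ k) := by fun_prop
  have h := (hX (A.map σ.toEmbedding)).comp hm
  have h1 : ((fun (x : ℕ → ℝ) k => x (σ k)) ∘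
      fun ω => flipSigns (A.map σ.toEmbedding) fun k => X k ω) =
      fun ω => flipSigns A fun k => X (σ k) ω := by
    ext ω k
    simp [flipSigns]
  rw [h1] at h
  exact h

/-- The reflection principle: with `S_m` fixed, reversing the later increments reflects `S_n` about
`S_m`. -/
theorem sum_flipSigns_Ico (α x : ℕ → ℝ) {m n : ℕ} (h : m ≤ n) :
    ∑ k ∈ Finset.range n, α k * flipSigns (Finset.Ico m n) x k =
      2 * ∑ k ∈ Finset.range m, α k * x k - ∑ k ∈ Finset.range n, α k * x k := by
  simp only [Finset.range_eq_Ico]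
  rw [← Finset.sum_Ico_consecutive _ (Nat.zero_le m) h,
    ← Finset.sum_Ico_consecutive (fun k => α k * x k) (Nat.zero_le m) h]
  have h1 : ∑ k ∈ Finset.Ico 0 m, α k * flipSigns (Finset.Ico m n) x k =
      ∑ k ∈ Finset.Ico 0 m, α k * x k :=
    Finset.sum_congr rfl fun k hk => by
      have := Finset.mem_Ico.1 hk
      rw [flipSigns, if_neg]; simp; omega
  have h2 : ∑ k ∈ Finset.Ico m n, α k * flipSigns (Finset.Ico m n) x k =
      -∑ k ∈ Finset.Ico m n, α k * x k := by
    rw [← Finset.sum_neg_distrib]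
    exact Finset.sum_congr rfl fun k hk => by rw [flipSigns, if_pos hk, mul_neg]
  rw [h1, h2]; ring

theorem sum_flipSigns_Ico_of_le (α x : ℕ → ℝ) {j m n : ℕ} (h : j ≤ m) :
    ∑ k ∈ Finset.range j, α k * flipSigns (Finset.Ico m n) x k =
      ∑ k ∈ Finset.range j, α k * x k :=
  Finset.sum_congr rfl fun k hk => by
    have := Finset.mem_range.1 hk
    rw [flipSigns, if_neg]; simp; omega

/-- **Lévy's maximal inequality**. -/
theorem IsSignSymmetric.measure_exists_le_abs_sum_le (hX : IsSignSymmetric μ X)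
    (hXm : ∀ k, Measurable (X k)) (α : ℕ → ℝ) (n : ℕ) (t : ℝ) :
    μ {ω | ∃ m ≤ n, t ≤ |∑ k ∈ Finset.range m, α k * X k ω|} ≤
      2 * μ {ω | t ≤ |∑ k ∈ Finset.range n, α k * X k ω|} := by
  let T : ℕ → (ℕ → ℝ) → ℝ := fun m x => ∑ k ∈ Finset.range m, α k * x k
  have hT : ∀ m, Measurable (T m) := fun m => by fun_prop
  let Y : Ω → ℕ → ℝ := fun ω k => X k ω
  have hY : Measurable Y := measurable_pi_lambda _ hXm
  -- `m` is the first time the level `t` is reached; this depends only on coordinates below `m`, so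
  -- flipping later signs preserves it.
  let A : ℕ → Set (ℕ → ℝ) := fun m => {x | t ≤ |T m x| ∧ ∀ j < m, |T j x| < t}
  let D : Set (ℕ → ℝ) := {x | t ≤ |T n x|}
  have hTabs : ∀ m, Measurable fun x => |T m x| := fun m => (hT m).abs
  have hD : MeasurableSet D := measurableSet_le measurable_const (hTabs n)
  have hA : ∀ m, MeasurableSet (A m) := by
    intro m
    refine (measurableSet_le measurable_const (hTabs m)).inter ?_
    have : {x | ∀ j < m, |T j x| < t} = ⋂ j, ⋂ (_ : j < m), {x | |T j x| < t} := by
      ext; simp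
    change MeasurableSet {x | ∀ j < m, |T j x| < t}
    rw [this]
    exact MeasurableSet.iInter fun j => MeasurableSet.iInter fun _ =>
      measurableSet_lt (hTabs j) measurable_const
  have hstep : ∀ m ≤ n, μ (Y ⁻¹' A m) ≤ 2 * μ (Y ⁻¹' (A m ∩ D)) := by
    intro m hm
    let F := flipSigns (Finset.Ico m n)
    -- On `A m`, if `|T n| < t` then `|2 T m - T n| > 2t - t = t`, so `T n` or its reflection
    -- reaches the level. By symmetry both events have the same measure.
    have hsub : Y ⁻¹' A m ⊆ Y ⁻¹' (A m ∩ D) ∪ (fun ω => F (Y ω)) ⁻¹' (A m ∩ D) := by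
      intro ω hω
      by_cases h : Y ω ∈ D
      · exact Or.inl ⟨hω, h⟩
      · right
        have h1 : T n (F (Y ω)) = 2 * T m (Y ω) - T n (Y ω) := sum_flipSigns_Ico α _ hm
        have h2 : ∀ j ≤ m, T j (F (Y ω)) = T j (Y ω) := fun j hj =>
          sum_flipSigns_Ico_of_le α _ hj
        have hω' : t ≤ |T m (Y ω)| ∧ ∀ j < m, |T j (Y ω)| < t := hω
        refine ⟨⟨?_, fun j hj => ?_⟩, ?_⟩
        · rw [h2 m le_rfl]; exact hω'.1
        · rw [h2 j hj.le]; exact hω'.2 j hj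
        · have h3 : |T n (Y ω)| < t := not_le.1 h
          change t ≤ |T n (F (Y ω))|
          rw [h1]
          have h4 := abs_sub_abs_le_abs_sub (2 * T m (Y ω)) (T n (Y ω))
          rw [abs_mul, abs_two] at h4
          linarith [hω'.1]
    calc μ (Y ⁻¹' A m) ≤ μ (Y ⁻¹' (A m ∩ D)) + μ ((fun ω => F (Y ω)) ⁻¹' (A m ∩ D)) :=
          (measure_mono hsub).trans (measure_union_le _ _)
      _ = 2 * μ (Y ⁻¹' (A m ∩ D)) := by
        rw [(hX (Finset.Ico m n)).measure_mem_eq ((hA m).inter hD), two_mul]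
  have hdisj : Set.PairwiseDisjoint (↑(Finset.range (n + 1))) fun m => Y ⁻¹' (A m ∩ D) := by
    intro i _ j _ hij
    refine Set.disjoint_left.2 fun ω hi hj => ?_
    have hi' : t ≤ |T i (Y ω)| ∧ ∀ l < i, |T l (Y ω)| < t := hi.1
    have hj' : t ≤ |T j (Y ω)| ∧ ∀ l < j, |T l (Y ω)| < t := hj.1
    rcases lt_or_gt_of_ne hij with h | h
    · exact absurd (hj'.2 i h) (not_lt.2 hi'.1)
    · exact absurd (hi'.2 j h) (not_lt.2 hj'.1)
  have hcover : {ω | ∃ m ≤ n, t ≤ |∑ k ∈ Finset.range m, α k * X k ω|} ⊆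
      ⋃ m ∈ Finset.range (n + 1), Y ⁻¹' A m := by
    rintro ω hω
    classical
    have hspec := Nat.find_spec hω
    simp only [Set.mem_iUnion]
    refine ⟨Nat.find hω, Finset.mem_range.2 (Nat.lt_succ_of_le hspec.1), hspec.2, fun j hj => ?_⟩
    have := Nat.find_min hω hj
    by_contra hcon
    exact this ⟨hj.le.trans hspec.1, not_lt.1 hcon⟩
  calc μ {ω | ∃ m ≤ n, t ≤ |∑ k ∈ Finset.range m, α k * X k ω|}
      ≤ ∑ m ∈ Finset.range (n + 1), μ (Y ⁻¹' A m) :=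
        (measure_mono hcover).trans (measure_biUnion_finset_le _ _)
    _ ≤ ∑ m ∈ Finset.range (n + 1), 2 * μ (Y ⁻¹' (A m ∩ D)) :=
        Finset.sum_le_sum fun m hm => hstep m (Nat.le_of_lt_succ (Finset.mem_range.1 hm))
    _ = 2 * μ (⋃ m ∈ Finset.range (n + 1), Y ⁻¹' (A m ∩ D)) := by
        rw [← Finset.mul_sum, measure_biUnion_finset hdisj fun m _ => hY ((hA m).inter hD)]
    _ ≤ 2 * μ {ω | t ≤ |∑ k ∈ Finset.range n, α k * X k ω|} := by
        gcongr
        exact Set.iUnion₂_subset fun m _ ω hω => hω.2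

/-! ### From tail bounds to bibasicity in `L^p`. -/

/-- A weak-type comparison of tails gives a comparison of `L^p` norms. -/
theorem eLpNorm_le_two_mul_of_measure_le {f g : Ω → ℝ} (hf : AEMeasurable f μ)
    (hg : AEMeasurable g μ) (h : ∀ t : ℝ, 0 < t → μ {ω | t ≤ |f ω|} ≤ 2 * μ {ω | t ≤ |g ω|})
    {p : ℝ≥0∞} (hp : 1 ≤ p) (hp' : p ≠ ⊤) : eLpNorm f p μ ≤ 2 * eLpNorm g p μ := by
  have hp0 : p ≠ 0 := (zero_lt_one.trans_le hp).ne'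
  have hpr : 1 ≤ p.toReal := by simpa using ENNReal.toReal_mono hp' hp
  have hpos : 0 < p.toReal := by linarith
  -- Layer-cake formula: the tails determine the `p`-th moment.
  have key : ∀ u : Ω → ℝ, AEMeasurable u μ → ∫⁻ ω, ‖u ω‖ₑ ^ p.toReal ∂μ =
      ENNReal.ofReal p.toReal * ∫⁻ t in Set.Ioi 0,
        μ {ω | t ≤ |u ω|} * ENNReal.ofReal (t ^ (p.toReal - 1)) := by
    intro u hu
    rw [← lintegral_rpow_eq_lintegral_meas_le_mul μ (f := fun ω => |u ω|)
      (ae_of_all _ fun ω => abs_nonneg _) hu.abs hpos]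
    refine lintegral_congr fun ω => ?_
    rw [← ENNReal.ofReal_rpow_of_nonneg (abs_nonneg _) hpos.le, Real.enorm_eq_ofReal_abs]
  have hI : ∫⁻ ω, ‖f ω‖ₑ ^ p.toReal ∂μ ≤ 2 * ∫⁻ ω, ‖g ω‖ₑ ^ p.toReal ∂μ := by
    rw [key f hf, key g hg, mul_left_comm, ← lintegral_const_mul' 2 _ (by simp)]
    refine mul_le_mul' le_rfl ?_
    refine setLIntegral_mono' measurableSet_Ioi fun t ht => ?_
    rw [← mul_assoc]
    gcongr
    exact h t ht
  rw [eLpNorm_eq_lintegral_rpow_enorm_toReal hp0 hp', eLpNorm_eq_lintegral_rpow_enorm_toReal hp0 hp']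
  calc (∫⁻ ω, ‖f ω‖ₑ ^ p.toReal ∂μ) ^ (1 / p.toReal)
      ≤ (2 * ∫⁻ ω, ‖g ω‖ₑ ^ p.toReal ∂μ) ^ (1 / p.toReal) := by gcongr
    _ = 2 ^ (1 / p.toReal) * (∫⁻ ω, ‖g ω‖ₑ ^ p.toReal ∂μ) ^ (1 / p.toReal) :=
        ENNReal.mul_rpow_of_nonneg _ _ (by positivity)
    _ ≤ 2 * (∫⁻ ω, ‖g ω‖ₑ ^ p.toReal ∂μ) ^ (1 / p.toReal) := by
        gcongr
        calc (2 : ℝ≥0∞) ^ (1 / p.toReal) ≤ 2 ^ (1 : ℝ) :=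
              ENNReal.rpow_le_rpow_of_exponent_le (by norm_num)
                (by rw [div_le_one hpos]; exact hpr)
          _ = 2 := ENNReal.rpow_one 2

theorem sum_smul_toLp {p : ℝ≥0∞} (hL : ∀ k, MemLp (X k) p μ) (α : ℕ → ℝ) (n : ℕ) :
    ∃ h : MemLp (fun ω => ∑ k ∈ Finset.range n, α k * X k ω) p μ,
      ∑ k ∈ Finset.range n, α k • (hL k).toLp (X k) = h.toLp _ := by
  induction n with
  | zero => exact ⟨by simp, by simp; rfl⟩
  | succ n ih =>
    obtain ⟨h, hs⟩ := ih
    have h' := h.add ((hL n).const_smul (α n))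
    have he : (fun ω => ∑ k ∈ Finset.range (n + 1), α k * X k ω) =
        (fun ω => ∑ k ∈ Finset.range n, α k * X k ω) + α n • X n := by
      ext ω; simp [Finset.sum_range_succ]
    refine ⟨he ▸ h', ?_⟩
    rw [Finset.sum_range_succ, hs, ← MemLp.toLp_const_smul, ← MemLp.toLp_add]
    congr 1
    exact he.symm

instance Lp.instPosSMulMonoReal {p : ℝ≥0∞} : PosSMulMono ℝ (Lp ℝ p μ) where
  smul_le_smul_of_nonneg_left c hc f g hfg := by
    rw [← Lp.coeFn_le] at hfg ⊢
    filter_upwards [Lp.coeFn_smul c f, Lp.coeFn_smul c g, hfg] with ω h1 h2 h3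
    rw [h1, h2]
    exact mul_le_mul_of_nonneg_left h3 hc

/-- A sign-symmetric sequence of nonzero functions is bibasic in `L^p`, `1 ≤ p < ∞`. -/
theorem IsSignSymmetric.isBibasic {p : ℝ≥0∞} [Fact (1 ≤ p)] (hp : p ≠ ⊤)
    (hX : IsSignSymmetric μ X) (hXm : ∀ k, Measurable (X k)) (hL : ∀ k, MemLp (X k) p μ)
    (h0 : ∀ k, (hL k).toLp (X k) ≠ 0) : IsBibasic fun k => (hL k).toLp (X k) := by
  refine isBibasic_of_maximal h0 (C := 2) fun α n => ?_
  choose hS hSe using fun m => sum_smul_toLp hL α m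
  let S : ℕ → Ω → ℝ := fun m ω => ∑ k ∈ Finset.range m, α k * X k ω
  have hSm : ∀ m, Measurable (S m) := fun m => by fun_prop
  -- The event `t ≤ M` is exactly the one bounded by Lévy's inequality, so `M` serves as the
  -- required majorant `B`.
  let M : Ω → ℝ := fun ω => (Finset.range (n + 1)).sup' Finset.nonempty_range_add_one fun m => |S m ω|
  have hMm : Measurable M := by
    have : M = (Finset.range (n + 1)).sup' Finset.nonempty_range_add_one fun m ω => |S m ω| := by
      ext ω; simp only [M, Finset.sup'_apply]
    rw [this]
    exact Finset.measurable_sup' _ fun m _ => (hSm m).abs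
  have hM0 : ∀ ω, 0 ≤ M ω := fun ω =>
    (abs_nonneg (S 0 ω)).trans (Finset.le_sup' (fun m => |S m ω|) (by simp))
  have hle : eLpNorm M p μ ≤ 2 * eLpNorm (S n) p μ := by
    refine eLpNorm_le_two_mul_of_measure_le hMm.aemeasurable (hSm n).aemeasurable
      (fun t _ => ?_) Fact.out hp
    refine le_trans (measure_mono fun ω hω => ?_) (hX.measure_exists_le_abs_sum_le hXm α n t)
    have hω' : t ≤ |M ω| := hω
    rw [abs_of_nonneg (hM0 ω)] at hω'
    obtain ⟨m, hm, h⟩ := (Finset.le_sup'_iff _).1 hω'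
    exact ⟨m, Nat.le_of_lt_succ (Finset.mem_range.1 hm), h⟩
  have hML : MemLp M p μ :=
    ⟨hMm.aestronglyMeasurable, hle.trans_lt (ENNReal.mul_lt_top (by simp) (hS n).2)⟩
  refine ⟨hML.toLp M, fun m hm => ?_, ?_⟩
  · rw [hSe, ← Lp.coeFn_le]
    filter_upwards [Lp.coeFn_abs ((hS m).toLp _), (hS m).coeFn_toLp, hML.coeFn_toLp]
      with ω h1 h2 h3
    rw [h1, h2, h3]
    exact Finset.le_sup' (fun m => |S m ω|) (Finset.mem_range.2 (Nat.lt_succ_of_le hm))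
  · rw [hSe, Lp.norm_toLp, Lp.norm_toLp]
    have := ENNReal.toReal_mono (ENNReal.mul_ne_top (by simp) (hS n).2.ne) hle
    simpa using this

end

/-! ### Joint distribution of the Rademacher functions. -/

instance : IsProbabilityMeasure unitIntervalMeasure := ⟨by simp⟩

theorem rademacherFun_zero_half_mul {u : ℝ} (hu : u ∈ Set.Ioo (0 : ℝ) 1) :
    rademacherFun 0 (1 / 2 * u + 0) = 1 := by
  have h : 2 ^ (0 + 1) * Real.pi * (1 / 2 * u + 0) = Real.pi * u := by ring
  rw [rademacherFun, h]
  refine Real.sign_of_pos (Real.sin_pos_of_pos_of_lt_pi (mul_pos Real.pi_pos hu.1) ?_)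
  nlinarith [Real.pi_pos, hu.2]

theorem rademacherFun_zero_half_mul_add_half {u : ℝ} (hu : u ∈ Set.Ioo (0 : ℝ) 1) :
    rademacherFun 0 (1 / 2 * u + 1 / 2) = -1 := by
  have h : 2 ^ (0 + 1) * Real.pi * (1 / 2 * u + 1 / 2) = Real.pi * u + Real.pi := by ring
  rw [rademacherFun, h, Real.sin_add_pi]
  refine Real.sign_of_neg (neg_neg_of_pos
    (Real.sin_pos_of_pos_of_lt_pi (mul_pos Real.pi_pos hu.1) ?_))
  nlinarith [Real.pi_pos, hu.2]

theorem rademacherFun_succ_half_mul (k : ℕ) (u : ℝ) :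
    rademacherFun (k + 1) (1 / 2 * u + 0) = rademacherFun k u := by
  have h : 2 ^ (k + 1 + 1) * Real.pi * (1 / 2 * u + 0) = 2 ^ (k + 1) * Real.pi * u := by ring
  rw [rademacherFun, h, rademacherFun]

theorem rademacherFun_succ_half_mul_add_half (k : ℕ) (u : ℝ) :
    rademacherFun (k + 1) (1 / 2 * u + 1 / 2) = rademacherFun k u := by
  have h : 2 ^ (k + 1 + 1) * Real.pi * (1 / 2 * u + 1 / 2) =
      2 ^ (k + 1) * Real.pi * u + ((2 ^ k : ℕ) : ℝ) * (2 * Real.pi) := by push_cast; ring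
  rw [rademacherFun, h, Real.sin_add_nat_mul_two_pi, rademacherFun]

/-- The sequence with first term `s` and remaining terms `y`. -/
def seqCons (s : ℝ) (y : ℕ → ℝ) : ℕ → ℝ
  | 0 => s
  | k + 1 => y k

/-- This affine change of variables is valid for arbitrary `G`, so the inductions on the
distribution need no measurability of `F`. -/
theorem setLIntegral_Ioo_half (c : ℝ) (G : ℝ → ℝ≥0∞) :
    ∫⁻ t in Set.Ioo c (c + 1 / 2), G t =
      2⁻¹ * ∫⁻ u in Set.Ioo (0 : ℝ) 1, G (1 / 2 * u + c) := by
  have himg : (fun u : ℝ => 1 / 2 * u + c) '' Set.Ioo 0 1 = Set.Ioo c (c + 1 / 2) := by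
    rw [Set.image_affine_Ioo (by norm_num)]
    congr 1 <;> ring
  rw [← himg, lintegral_image_eq_lintegral_abs_deriv_mul (f' := fun _ => 1 / 2) measurableSet_Ioo
    (fun u _ => ?_) (fun u _ v _ h => by simpa using h), lintegral_const_mul' _ _ (by simp)]
  · congr 1
    rw [abs_of_pos (by norm_num), one_div, ENNReal.ofReal_inv_of_pos (by norm_num)]
    simp
  · simpa using (((hasDerivAt_id u).const_mul (1 / 2 : ℝ)).add_const c).hasDerivWithinAt

/-- The joint distribution of the Rademacher functions is self-similar. -/
theorem lintegral_rademacherFun_seq (F : (ℕ → ℝ) → ℝ≥0∞) :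
    ∫⁻ t, F (fun k => rademacherFun k t) ∂unitIntervalMeasure =
      2⁻¹ * ∫⁻ u, F (seqCons 1 fun k => rademacherFun k u) ∂unitIntervalMeasure +
      2⁻¹ * ∫⁻ u, F (seqCons (-1) fun k => rademacherFun k u) ∂unitIntervalMeasure := by
  -- The points 0, 1/2 and 1, where the first Rademacher function vanishes, are discarded as null.
  have hIcc : unitIntervalMeasure = volume.restrict (Set.Ioo (0 : ℝ) 1) :=
    Measure.restrict_congr_set Ioo_ae_eq_Icc.symm
  have hsplit : volume.restrict (Set.Ioo (0 : ℝ) 1) =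
      volume.restrict (Set.Ioo (0 : ℝ) (0 + 1 / 2)) +
        volume.restrict (Set.Ioo (1 / 2 : ℝ) (1 / 2 + 1 / 2)) := by
    rw [← Measure.restrict_union (by
      rw [Set.disjoint_left]; rintro x ⟨_, h1⟩ ⟨h2, _⟩; linarith) measurableSet_Ioo]
    have h : Set.Ioo (0 : ℝ) (0 + 1 / 2) ∪ Set.Ioo (1 / 2 : ℝ) (1 / 2 + 1 / 2) =
        Set.Ioo 0 1 \ {1 / 2} := by
      ext x
      simp only [Set.mem_union, Set.mem_Ioo, Set.mem_sdiff, Set.mem_singleton_iff]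
      constructor
      · rintro (⟨h1, h2⟩ | ⟨h1, h2⟩)
        · exact ⟨⟨h1, by linarith⟩, by linarith⟩
        · exact ⟨⟨by linarith, by linarith⟩, by linarith⟩
      · rintro ⟨⟨h1, h2⟩, h3⟩
        rcases lt_or_gt_of_ne h3 with h | h
        · exact Or.inl ⟨h1, by linarith⟩
        · exact Or.inr ⟨h, by linarith⟩
    rw [h]
    exact Measure.restrict_congr_set (sdiff_null_ae_eq_self (by simp)).symm
  rw [hIcc]
  conv_lhs => rw [hsplit, lintegral_add_measure, setLIntegral_Ioo_half, setLIntegral_Ioo_half]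
  congr 2
  · refine setLIntegral_congr_fun measurableSet_Ioo fun u hu => ?_
    congr 1
    ext k
    cases k with
    | zero => exact rademacherFun_zero_half_mul hu
    | succ k => exact rademacherFun_succ_half_mul k u
  · refine setLIntegral_congr_fun measurableSet_Ioo fun u hu => ?_
    congr 1
    ext k
    cases k with
    | zero => exact rademacherFun_zero_half_mul_add_half hu
    | succ k => exact rademacherFun_succ_half_mul_add_half k u

theorem flipSigns_seqCons_zero (s : ℝ) (y : ℕ → ℝ) :
    flipSigns {0} (seqCons s y) = seqCons (-s) y := by
  ext k; cases k <;> simp [flipSigns, seqCons]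

theorem flipSigns_seqCons_succ (k : ℕ) (s : ℝ) (y : ℕ → ℝ) :
    flipSigns {k + 1} (seqCons s y) = seqCons s (flipSigns {k} y) := by
  ext j; cases j <;> simp [flipSigns, seqCons]

/-- Flipping the first sign swaps the two halves of the interval; flipping sign `k + 1` flips sign
`k` of the rescaled sequence within each half. -/
theorem lintegral_flipSigns_singleton (k : ℕ) (F : (ℕ → ℝ) → ℝ≥0∞) :
    ∫⁻ t, F (flipSigns {k} fun j => rademacherFun j t) ∂unitIntervalMeasure =
      ∫⁻ t, F (fun j => rademacherFun j t) ∂unitIntervalMeasure := by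
  induction k generalizing F with
  | zero =>
    rw [lintegral_rademacherFun_seq F, lintegral_rademacherFun_seq fun y => F (flipSigns {0} y)]
    simp only [flipSigns_seqCons_zero, neg_neg]
    rw [add_comm]
  | succ k ih =>
    rw [lintegral_rademacherFun_seq F,
      lintegral_rademacherFun_seq fun y => F (flipSigns {k + 1} y)]
    simp only [flipSigns_seqCons_succ]
    rw [ih fun y => F (seqCons 1 y), ih fun y => F (seqCons (-1) y)]

theorem flipSigns_insert {k : ℕ} {A : Finset ℕ} (hk : k ∉ A) (y : ℕ → ℝ) :
    flipSigns (insert k A) y = flipSigns A (flipSigns {k} y) := by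
  ext j
  by_cases h : j = k
  · subst h; simp [flipSigns, hk]
  · simp [flipSigns, h]

theorem lintegral_flipSigns (A : Finset ℕ) (F : (ℕ → ℝ) → ℝ≥0∞) :
    ∫⁻ t, F (flipSigns A fun j => rademacherFun j t) ∂unitIntervalMeasure =
      ∫⁻ t, F (fun j => rademacherFun j t) ∂unitIntervalMeasure := by
  induction A using Finset.induction_on generalizing F with
  | empty =>
    have h : ∀ y, flipSigns ∅ y = y := fun y => by ext k; simp [flipSigns]
    simp only [h]
  | insert k A hk ih =>
    simp_rw [flipSigns_insert hk]
    rw [lintegral_flipSigns_singleton k fun y => F (flipSigns A y), ih]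

theorem isSignSymmetric_rademacherFun : IsSignSymmetric unitIntervalMeasure rademacherFun := by
  intro A
  have hY : Measurable fun (t : ℝ) k => rademacherFun k t :=
    measurable_pi_lambda _ measurable_rademacherFun
  have hF : Measurable fun t => flipSigns A fun k => rademacherFun k t :=
    (measurable_flipSigns A).comp hY
  refine ⟨hF.aemeasurable, hY.aemeasurable, Measure.ext fun s hs => ?_⟩
  rw [← lintegral_indicator_one hs, ← lintegral_indicator_one hs,
    lintegral_map (measurable_one.indicator hs) hF, lintegral_map (measurable_one.indicator hs) hY]
  exact lintegral_flipSigns A _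

/-- Exceptions occur where the sine vanishes, as `Real.sign 0 = 0`. Self-similarity shows that they
form a null set without locating them. -/
theorem abs_rademacherFun_ae (k : ℕ) : ∀ᵐ t ∂unitIntervalMeasure, |rademacherFun k t| = 1 := by
  have hset : ∀ k, MeasurableSet {t | |rademacherFun k t| = 1} := fun k =>
    measurableSet_eq_fun (measurable_rademacherFun k).abs measurable_const
  have key : ∫⁻ t, ({y : ℕ → ℝ | |y k| ≠ 1}.indicator 1 fun j => rademacherFun j t)
      ∂unitIntervalMeasure = 0 := by
    induction k with
    | zero =>
      rw [lintegral_rademacherFun_seq]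
      simp [seqCons, Set.indicator]
    | succ k ih =>
      have h : ∀ s y, ({y : ℕ → ℝ | |y (k + 1)| ≠ 1}.indicator 1 (seqCons s y) : ℝ≥0∞) =
          {y : ℕ → ℝ | |y k| ≠ 1}.indicator 1 y := fun s y => by
        by_cases hy : |y k| = 1 <;> simp [Set.indicator, seqCons, hy]
      rw [lintegral_rademacherFun_seq]
      simp only [h, ih]
      simp
  have h2 : ∫⁻ t, ({t : ℝ | |rademacherFun k t| = 1}ᶜ.indicator 1 t) ∂unitIntervalMeasure = 0 := by
    rw [← key]; rfl
  rwa [lintegral_indicator_one (hset k).compl] at h2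

/-! ### The Rademacher sequence in `L_p` and failure of absoluteness. -/

theorem abs_rademacher_eq_const (p : ℝ≥0∞) (k : ℕ) :
    |rademacher p k| = Lp.const p unitIntervalMeasure (1 : ℝ) := by
  ext1
  filter_upwards [Lp.coeFn_abs (rademacher p k), (memLp_rademacherFun p k).coeFn_toLp,
    Lp.coeFn_const (p := p) (μ := unitIntervalMeasure) (1 : ℝ), abs_rademacherFun_ae k]
    with t h1 h2 h3 h4
  rw [h1, h3, rademacher, h2, h4]; rfl

theorem norm_const_one (p : ℝ≥0∞) [Fact (1 ≤ p)] :
    ‖Lp.const p unitIntervalMeasure (1 : ℝ)‖ = 1 := by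
  rw [Lp.norm_const _ _ _ (zero_lt_one.trans_le (Fact.out : 1 ≤ p)).ne']; simp

theorem rademacher_ne_zero (p : ℝ≥0∞) [Fact (1 ≤ p)] (k : ℕ) : rademacher p k ≠ 0 := by
  intro h
  have h1 := norm_const_one p
  rw [← abs_rademacher_eq_const p k, h] at h1
  simp at h1

/-- Averaging with the flip of the last sign removes the cross term: `(S + r)² + (S - r)² = 2S² + 2`
when `r² = 1`. Each new term thus adds 1. -/
theorem lintegral_sq_sum_rademacherFun (n : ℕ) :
    ∫⁻ t, ENNReal.ofReal ((∑ k ∈ Finset.range n, rademacherFun k t) ^ 2) ∂unitIntervalMeasure =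
      n := by
  induction n with
  | zero => simp
  | succ n ih =>
    have hflip := lintegral_flipSigns {n} fun y =>
      ENNReal.ofReal ((∑ k ∈ Finset.range (n + 1), y k) ^ 2)
    have h1 : ∀ t, ∑ k ∈ Finset.range (n + 1), flipSigns {n} (fun j => rademacherFun j t) k =
        ∑ k ∈ Finset.range n, rademacherFun k t - rademacherFun n t := by
      intro t
      rw [Finset.sum_range_succ, sub_eq_add_neg]
      congr 1
      · exact Finset.sum_congr rfl fun k hk => by simp [flipSigns, (Finset.mem_range.1 hk).ne]
      · simp [flipSigns]
    simp only [h1] at hflip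
    have hm : ∀ m, Measurable fun t => ∑ k ∈ Finset.range m, rademacherFun k t := fun m =>
      Finset.measurable_fun_sum _ fun k _ => measurable_rademacherFun k
    have hsum : 2 * ∫⁻ t, ENNReal.ofReal ((∑ k ∈ Finset.range (n + 1), rademacherFun k t) ^ 2)
        ∂unitIntervalMeasure = 2 * ((n + 1 : ℕ) : ℝ≥0∞) := by
      conv_lhs => rw [two_mul]
      conv_lhs => enter [1]; rw [← hflip]
      rw [← lintegral_add_right _ ((hm _).pow_const 2).ennreal_ofReal]
      calc _ = ∫⁻ t, (2 * ENNReal.ofReal ((∑ k ∈ Finset.range n, rademacherFun k t) ^ 2) + 2)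
            ∂unitIntervalMeasure := by
            refine lintegral_congr_ae ?_
            filter_upwards [abs_rademacherFun_ae n] with t ht
            have hsq : rademacherFun n t ^ 2 = 1 := by rw [← sq_abs, ht, one_pow]
            rw [← ENNReal.ofReal_add (by positivity) (by positivity), Finset.sum_range_succ]
            have h2 : ENNReal.ofReal 2 = 2 := by simp
            rw [← h2, ← ENNReal.ofReal_mul zero_le_two, ← ENNReal.ofReal_add (by positivity)
              zero_le_two]
            congr 1
            linear_combination 2 * hsq
        _ = 2 * ((n + 1 : ℕ) : ℝ≥0∞) := by
            rw [lintegral_add_right _ measurable_const, lintegral_const_mul' _ _ (by simp), ih]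
            simp; ring
    exact (ENNReal.mul_right_inj (by simp) (by simp)).1 hsum

theorem not_isAbsolute_rademacher (p : ℝ≥0∞) [Fact (1 ≤ p)] (hp : p ≠ ⊤) :
    ¬ IsAbsolute (rademacher p) := by
  rintro ⟨A, hA1, hA⟩
  have hp0 : p ≠ 0 := (zero_lt_one.trans_le (Fact.out : 1 ≤ p)).ne'
  have hq : 1 ≤ p.toReal := by simpa using ENNReal.toReal_mono hp (Fact.out : 1 ≤ p)
  set q := p.toReal
  have hq0 : 0 < q := by linarith
  -- With `m = k²` terms the bound below is `‖S‖^q ≤ m^q / k`, so absoluteness would force `k ≤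
  -- A^q`.
  obtain ⟨k, hk⟩ := exists_nat_gt (A ^ q)
  have hk0 : (0 : ℝ) < k := (Real.rpow_nonneg (by linarith) q).trans_lt hk
  set m : ℕ := k ^ 2
  have hm : (m : ℝ) = (k : ℝ) ^ 2 := by simp [m]
  have hm0 : (0 : ℝ) < m := by rw [hm]; positivity
  let S : ℝ → ℝ := fun t => ∑ j ∈ Finset.range m, rademacherFun j t
  have hSm : Measurable S :=
    Finset.measurable_fun_sum _ fun k _ => measurable_rademacherFun k
  -- Since `|S| / m ≤ 1` and `q ≥ 1`, the power `q` may be dropped; then `2k|S| ≤ k² + S²` reduces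
  -- everything to the second moment `k²`. The two summands contribute `1 / (2k)` each.
  have hpt : ∀ᵐ t ∂unitIntervalMeasure, ‖S t‖ₑ ^ q ≤
      ENNReal.ofReal ((m : ℝ) ^ q * (1 / (2 * k))) +
        ENNReal.ofReal ((m : ℝ) ^ q * (1 / (2 * k ^ 3))) * ENNReal.ofReal (S t ^ 2) := by
    filter_upwards [ae_all_iff.2 abs_rademacherFun_ae] with t ht
    have hle : |S t| ≤ m := by
      refine (Finset.abs_sum_le_sum_abs _ _).trans ?_
      simp [ht]
    have hu1 : |S t| / m ≤ 1 := (div_le_one hm0).2 hle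
    have hu0 : 0 ≤ |S t| / m := by positivity
    have h1 : (|S t| / m) ^ q ≤ |S t| / m := by
      simpa using Real.rpow_le_rpow_of_exponent_ge' hu0 hu1 zero_le_one hq
    have h2 : |S t| / m ≤ 1 / (2 * k) + 1 / (2 * k ^ 3) * S t ^ 2 := by
      rw [← sq_abs (S t), hm, div_add' _ _ _ (by positivity), div_le_div_iff₀ (by positivity)
        (by positivity)]
      have h3 : 1 / (2 * (k : ℝ) ^ 3) * |S t| ^ 2 * (2 * k) = |S t| ^ 2 / k ^ 2 := by
        field_simp
      rw [h3, add_mul, div_mul_cancel₀ _ (by positivity)]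
      nlinarith [sq_nonneg ((k : ℝ) - |S t|)]
    rw [← ENNReal.ofReal_mul (by positivity), ← ENNReal.ofReal_add (by positivity) (by positivity),
      Real.enorm_eq_ofReal_abs, ENNReal.ofReal_rpow_of_nonneg (abs_nonneg _) hq0.le]
    refine ENNReal.ofReal_le_ofReal ?_
    calc |S t| ^ q = (m : ℝ) ^ q * (|S t| / m) ^ q := by
          rw [← Real.mul_rpow hm0.le hu0, mul_div_cancel₀ _ hm0.ne']
      _ ≤ (m : ℝ) ^ q * (1 / (2 * k) + 1 / (2 * k ^ 3) * S t ^ 2) := by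
          gcongr; exact h1.trans h2
      _ = _ := by ring
  have hint : ∫⁻ t, ‖S t‖ₑ ^ q ∂unitIntervalMeasure ≤ ENNReal.ofReal ((m : ℝ) ^ q / k) := by
    refine (lintegral_mono_ae hpt).trans_eq ?_
    rw [lintegral_add_left measurable_const, lintegral_const_mul' _ _ (by simp),
      lintegral_sq_sum_rademacherFun, lintegral_const, measure_univ, mul_one,
      ← ENNReal.ofReal_natCast, ← ENNReal.ofReal_mul (by positivity),
      ← ENNReal.ofReal_add (by positivity) (by positivity)]
    congr 1
    rw [hm]; field_simp; ring
  obtain ⟨hSL, hSe⟩ := sum_smul_toLp (memLp_rademacherFun p) (fun _ => 1) m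
  have hSL' : (fun t => ∑ j ∈ Finset.range m, (1 : ℝ) * rademacherFun j t) = S := by
    ext t; simp [S]
  have hnorm : ‖∑ j ∈ Finset.range m, (fun _ => (1 : ℝ)) j • rademacher p j‖ ^ q ≤
      (m : ℝ) ^ q / k := by
    have h1 : ∑ j ∈ Finset.range m, (fun _ => (1 : ℝ)) j • rademacher p j = hSL.toLp _ := hSe
    rw [h1, Lp.norm_toLp, hSL', eLpNorm_eq_lintegral_rpow_enorm_toReal hp0 hp,
      ENNReal.toReal_rpow, ← ENNReal.rpow_mul, one_div_mul_cancel hq0.ne', ENNReal.rpow_one]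
    exact ENNReal.toReal_le_of_le_ofReal (by positivity) hint
  have hmain := hA m fun _ => 1
  have hl : ‖∑ j ∈ Finset.range m, |(fun _ => (1 : ℝ)) j • rademacher p j|‖ = m := by
    simp only [one_smul, abs_rademacher_eq_const, Finset.sum_const, Finset.card_range]
    rw [← Nat.cast_smul_eq_nsmul ℝ, norm_smul, norm_const_one]; simp
  rw [hl] at hmain
  have h1 := Real.rpow_le_rpow hm0.le hmain hq0.le
  rw [Real.mul_rpow (by linarith) (norm_nonneg _)] at h1
  have h2 : (m : ℝ) ^ q ≤ A ^ q * ((m : ℝ) ^ q / k) := h1.trans (by gcongr)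
  have h3 : 0 < (m : ℝ) ^ q := Real.rpow_pos_of_pos hm0 q
  rw [mul_div_assoc', le_div_iff₀ hk0, mul_comm] at h2
  exact absurd (le_of_mul_le_mul_right h2 h3) (not_le.2 hk)

theorem proposition8p1 (p : ℝ≥0∞) [Fact (1 ≤ p)] (hp : p ≠ ⊤) :
    IsBibasic (rademacher p) ∧ IsPermutable (rademacher p) ∧ ¬ IsAbsolute (rademacher p) := by
  have hperm : IsPermutable (rademacher p) := fun σ =>
    (isSignSymmetric_rademacherFun.comp_perm σ).isBibasic hp
      (fun k => measurable_rademacherFun (σ k)) (fun k => memLp_rademacherFun p (σ k))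
      fun k => rademacher_ne_zero p (σ k)
  exact ⟨hperm (Equiv.refl ℕ), hperm, not_isAbsolute_rademacher p hp⟩
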